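/- \textbf{Setting.} Let $K\ge 0$ be an integer and let player $1$ be the leader and player $2$ the follower. The state evolves by $x_{k+1}=f_k(x_k,u_k^1,u_k^2)\in\mathbb R^n$ for $0\le k<K$, with $x_0$ given and $u_k^i\in\mathbb R^{m_i}$. At every instant $0\le k\le K$ the players also take decisions $v_k^i\in\mathbb R^{s_i}$, subject to $h_k^i(x_k,v_k^1,v_k^2)\ge 0$ (with values in $\mathbb R^{c_i}$) and $v_k^i\ge 0$, $i\in\{1,2\}$. Write $\mathsf V_k(x)$ for the set of pairs $\mathsf v=(v^1,v^2)$ that satisfy these constraints for $i=1,2$, and $\mathsf U_k(x)=\{\mathsf u=(u^1,u^2):\mathsf V_{k+1}(f_k(x,u^1,u^2))\ne\emptyset\}$. The reachable sets are $\mathsf X_0=\{x_0\}$ and $\mathsf X_{k+1}=\{f_k(x,\mathsf u):x\in\mathsf X_k,\ \mathsf u\in\mathsf U_k(x)\}$. Player $i$ minimizes $$J_i=g_K^i(x_K,\mathsf v_K)+\sum_{k=0}^{K-1}g_k^i(x_k,\mathsf u_k,\mathsf v_k).$$ At each $k<K$ the leader chooses $u_k^1$, then the follower chooses $u_k^2$,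 then both choose $v_k^1,v_k^2$ simultaneously; at $K$ only $v_K^1,v_K^2$ are chosen, simultaneously. A strategy of player $i$ consists of maps $\gamma_k^i$ ($k<K$) on $\mathsf X_k$ with $u_k^i=\gamma_k^i(x_k)$, and of decisions $v_k^i=v_k^i(x_k)$ ($k\le K$). Let $\Gamma_k^1$ be the set of measurable $\gamma^1:\mathsf X_k\to\mathbb R^{m_1}$ such that for every $x\in\mathsf X_k$ some $u^2$ satisfies $(\gamma^1(x),u^2)\in\mathsf U_k(x)$. For $\gamma^1\in\Gamma_k^1$ let $\Gamma_k^2=\Gamma_k^2(\gamma^1)$ be the set of measurable $\gamma^2:\mathsf X_k\to\mathbb R^{m_2}$ with $(\gamma^1(x),\gamma^2(x))\in\mathsf U_k(x)$ for all $x\in\mathsf X_k$. Pairs of strategies are admissible if $\gamma_k^1\in\Gamma_k^1$, $\gamma_k^2\in\Gamma_k^2(\gamma_k^1)$ for $k<K$, and $(v_k^1(x),v_k^2(x))\in\mathsf V_k(x)$ for all $k\le K$, $x\in\mathsf X_k$. \textbf{Solution concept.} An admissible pair $\psi^\star=(\gamma_k^{i\star},v_k^{i\star})$ is a \emph{feedback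 Stackelberg--Nash (FSN) solution} if: (1) for all admissible play before $K$, neither player $i$ can lower $J_i$ by changing $v_K^{i\star}$ alone within $\{v^i:(v^i,v_K^{j\star})\in\mathsf V_K\}$; (2) for every $k<K$, with the decisions after $k$ fixed at $\psi^\star$, and for all admissible play before $k$: (a) for all $\gamma^1\in\Gamma_k^1$, $\gamma^2\in\Gamma_k^2(\gamma^1)$ used at $k$, neither player $i$ can lower $J_i$ by changing $v_k^{i\star}$ alone within $\{v^i:(v^i,v_k^{j\star})\in\mathsf V_k\}$; (b) there is a map $\mathsf R_k^2$, not depending on the play before $k$, that sends every $\gamma^1\in\Gamma_k^1$ to the unique element of $\Gamma_k^2(\gamma^1)$ that minimizes $J_2$ over $\Gamma_k^2(\gamma^1)$ for all admissible play before $k$, the simultaneous decisions at $k$ being $v_k^\star$; (c) $\gamma_k^{1\star}$ minimizes $J_1$ over $\gamma^1\in\Gamma_k^1$ when the follower uses $\mathsf R_k^2(\gamma^1)$ and the simultaneous decisions at $k$ are $v_k^\star$, and $\gamma_k^{2\star}=\mathsf R_k^2(\gamma_k^{1\star})$. An FSN solution $\psi^\star$ is \emph{strongly time consistent} if for every $k_0\in\{0,\dots,K\}$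 and every admissible play before $k_0$ (not only that of $\psi^\star$), leading to a state $x_{k_0}$, the truncation of $\psi^\star$ to $\{k_0,\dots,K\}$ is an FSN solution of the game that starts at the instant $k_0$ in $x_{k_0}$. \textbf{Hypotheses.} (i) For all $k\le K$ and $x\in\mathsf X_k$, $\mathsf V_k(x)$ is nonempty, convex, closed and bounded; all $f_k$, $h_k^i$, $g_k^i$ are continuously differentiable; and $\partial h_k^i/\partial v_k^i$ has full rank at all $\mathsf v\in\mathsf V_k(x)$, $x\in\mathsf X_k$. (ii) $g_k^i(x,\mathsf u,\mathsf v)=g_{u,k}^i(x,\mathsf u)+g_{v,k}^i(x,\mathsf v)$ for $k<K$; put $g_{v,K}^i=g_K^i$. (iii) For all $k\le K$ and $x\in\mathsf X_k$ the costs $g_{v,k}^i(x,\cdot)$ are diagonally strictly convex: with $\nabla g_{v,k}=(\nabla_{v^i}g_{v,k}^i)_{i=1,2}$, $$(\alpha-\beta)'\nabla g_{v,k}(x,\beta)+(\beta-\alpha)'\nabla g_{v,k}(x,\alpha)<0\qquad\text{for all }\alpha\ne\beta\text{ in }\mathbb R^{s_1+s_2}.$$ \textbf{Theorem.} Under (i)--(iii),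 suppose that there are functions $W^i(k,\cdot):\mathsf X_k\to\mathbb R$ ($0\le k\le K$, $i\in\{1,2\}$) and $\gamma_k^{i\star},v_k^{i\star}$ such that for all $k<K$, $\gamma^1\in\Gamma_k^1$, $x\in\mathsf X_k$ the function $$u^2\mapsto g_{u,k}^2(x,\gamma^1(x),u^2)+W^2(k+1,f_k(x,\gamma^1(x),u^2))$$ is strictly convex on the (convex) set $\{u^2:(\gamma^1(x),u^2)\in\mathsf U_k(x)\}$, and such that the following holds. \begin{enumerate} \item For all $k\le K$ and $x\in\mathsf X_k$, $\mathsf v_k^\star=\mathsf v_k^\star(x)$ together with some multiplier $(\mu^1,\mu^2)$ solves the complementarity problem $\mathrm{pCP}_k(x)$: $$0\le\begin{bmatrix}\big(\nabla_{v^i}g_{v,k}^i(x,\mathsf v_k^\star)-(\mu^{i})'\nabla_{v^i}h_k^i(x,\mathsf v_k^\star)\big)_{i=1,2}\\ \big(h_k^i(x,\mathsf v_k^\star)\big)_{i=1,2}\end{bmatrix}\perp\begin{bmatrix}\mathsf v_k^\star\\ (\mu^i)_{i=1,2}\end{bmatrix}\ge 0 .$$ \item $W^i(K,x)=g_K^i(x,\mathsf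 v_K^\star(x))$ for $x\in\mathsf X_K$. \item For all $k<K$ and $x\in\mathsf X_k$, $W^i(k,x)=g_k^i(x,\gamma_k^{1\star}(x),\gamma_k^{2\star}(x),\mathsf v_k^\star(x))+W^i(k+1,f_k(x,\gamma_k^{1\star}(x),\gamma_k^{2\star}(x)))$. \item For every $k<K$ there is a map $\mathsf R_k^2$ such that for all $\gamma^1\in\Gamma_k^1$ the map $\mathsf R_k^2(\gamma^1)\in\Gamma_k^2(\gamma^1)$ minimizes $g_{u,k}^2(x,\gamma^1(x),\gamma^2(x))+W^2(k+1,f_k(x,\gamma^1(x),\gamma^2(x)))$ over $\gamma^2\in\Gamma_k^2(\gamma^1)$ for every $x\in\mathsf X_k$; $\gamma_k^{1\star}\in\Gamma_k^1$ minimizes $g_{u,k}^1(x,\gamma^1(x),\mathsf R_k^2(\gamma^1)(x))+W^1(k+1,f_k(x,\gamma^1(x),\mathsf R_k^2(\gamma^1)(x)))$ over $\gamma^1\in\Gamma_k^1$ for every $x\in\mathsf X_k$; and $\gamma_k^{2\star}=\mathsf R_k^2(\gamma_k^{1\star})$. \end{enumerate} Then $\psi^{i\star}=((\gamma_k^{i\star},v_k^{i\star})_{k<K},v_K^{i\star})$,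 $i=1,2$, is an FSN solution, and it is strongly time consistent. -/

import Mathlib

/-- Euclidean space of dimension `d`. -/
abbrev Vec (d : ℕ) := EuclideanSpace ℝ (Fin d)

/-- Joint actions of the two players: `a 0` belongs to the leader, `a 1` to the follower. -/
abbrev Joint (d : Fin 2 → ℕ) := (i : Fin 2) → Vec (d i)

/-- The pair consisting of an object of the leader and an object of the follower. -/
def pair {A : Fin 2 → Type*} (a : A 0) (b : A 1) : (i : Fin 2) → A i
  | 0 => a
  | 1 => b

/-- Data of a two-player difference game over the instants `0, …, K` with two kinds of decisions:
`u` (driving the state, chosen sequentially) and `v` (chosen simultaneously, subject to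
`h k i x v ≥ 0` and `v i ≥ 0`). Player `0` is the leader, player `1` the follower. Only
`f k`, `g k` with `k < K` and `h k` with `k ≤ K` are ever used. -/
structure QHGame (n : ℕ) (m s c : Fin 2 → ℕ) where
  /-- horizon -/
  K : ℕ
  /-- initial state -/
  x0 : Vec n
  /-- dynamics -/
  f : ℕ → Vec n → Joint m → Vec n
  /-- constraint functions -/
  h : ℕ → (i : Fin 2) → Vec n → Joint s → Vec (c i)
  /-- instantaneous costs -/
  g : ℕ → Fin 2 → Vec n → Joint m → Joint s → ℝ
  /-- terminal costs -/
  gK : Fin 2 → Vec n → Joint s → ℝ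

/-- What both players do at one instant: maps from the current state to the actions of either
kind. -/
structure Stage (n : ℕ) (m s : Fin 2 → ℕ) where
  γ : (i : Fin 2) → Vec n → Vec (m i)
  v : (i : Fin 2) → Vec n → Vec (s i)

/-- A pair of feedback strategies, as a sequence of stages (at the last instant only the
component `v` matters). -/
abbrev Strategies (n : ℕ) (m s : Fin 2 → ℕ) := ℕ → Stage n m s

namespace Stage

variable {n : ℕ} {m s : Fin 2 → ℕ}

/-- The joint sequential action at the state `x`. -/
def uAt (σ : Stage n m s) (x : Vec n) : Joint m := fun i => σ.γ i x

/-- The joint simultaneous action at the state `x`. -/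
def vAt (σ : Stage n m s) (x : Vec n) : Joint s := fun i => σ.v i x

end Stage

/-- Play `ψ` before the instant `k`, `σ` at `k`, and `ψs` after `k`. -/
def splice {n : ℕ} {m s : Fin 2 → ℕ} (k : ℕ) (ψ : Strategies n m s) (σ : Stage n m s)
    (ψs : Strategies n m s) : Strategies n m s :=
  fun t => if t < k then ψ t else if t = k then σ else ψs t

namespace QHGame

variable {n : ℕ} {m s c : Fin 2 → ℕ}

/-- Joint admissible set of the simultaneous decisions. -/
def V (G : QHGame n m s c) (k : ℕ) (x : Vec n) : Set (Joint s) :=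
  {v | ∀ i, (∀ l, 0 ≤ G.h k i x v l) ∧ ∀ l, 0 ≤ v i l}

/-- Joint admissible set of the sequential decisions: those that keep the next stage feasible. -/
def U (G : QHGame n m s c) (k : ℕ) (x : Vec n) : Set (Joint m) :=
  {u | (G.V (k + 1) (G.f k x u)).Nonempty}

/-- The set of states that can be reached at the instant `k` by admissible actions. -/
def Reach (G : QHGame n m s c) : ℕ → Set (Vec n)
  | 0 => {G.x0}
  | k + 1 => {y | ∃ x ∈ G.Reach k, ∃ u ∈ G.U k x, y = G.f k x u}

/-- Admissible sequential policies of the leader at `k`: measurable maps on the reachable set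
whose values leave the follower an admissible action. -/
def leaderMaps (G : QHGame n m s c) (k : ℕ) : Set (Vec n → Vec (m 0)) :=
  {a | Measurable ((G.Reach k).domRestrict a) ∧ ∀ x ∈ G.Reach k, ∃ u ∈ G.U k x, u 0 = a x}

/-- Admissible sequential policies of the follower at `k` against the policy `a` of the leader. -/
def followerMaps (G : QHGame n m s c) (k : ℕ) (a : Vec n → Vec (m 0)) :
    Set (Vec n → Vec (m 1)) :=
  {b | Measurable ((G.Reach k).domRestrict b) ∧ ∀ x ∈ G.Reach k, pair (a x) (b x) ∈ G.U k x}

/-- Admissible simultaneous decisions of player `i` at `k` (one action for every reachable state)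
against the decision of the other player in `v`. -/
def simMaps (G : QHGame n m s c) (k : ℕ) (i : Fin 2) (v : (j : Fin 2) → Vec n → Vec (s j)) :
    Set (Vec n → Vec (s i)) :=
  {w | ∀ x ∈ G.Reach k, Function.update (fun j => v j x) i (w x) ∈ G.V k x}

/-- Joint admissibility of the decisions at an instant `k < K`. -/
def AdmissibleAt (G : QHGame n m s c) (k : ℕ) (σ : Stage n m s) : Prop :=
  σ.γ 0 ∈ G.leaderMaps k ∧ σ.γ 1 ∈ G.followerMaps k (σ.γ 0) ∧ ∀ x ∈ G.Reach k, σ.vAt x ∈ G.V k x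

/-- Joint admissibility of the decisions before the instant `k`. -/
def AdmissibleBefore (G : QHGame n m s c) (k : ℕ) (ψ : Strategies n m s) : Prop :=
  ∀ t < k, G.AdmissibleAt t (ψ t)

/-- Joint admissibility of a pair of strategies. -/
def Admissible (G : QHGame n m s c) (ψ : Strategies n m s) : Prop :=
  G.AdmissibleBefore G.K ψ ∧ ∀ x ∈ G.Reach G.K, (ψ G.K).vAt x ∈ G.V G.K x

/-- The state trajectory generated by a pair of strategies. -/
def state (G : QHGame n m s c) (ψ : Strategies n m s) : ℕ → Vec n
  | 0 => G.x0
  | k + 1 => G.f k (G.state ψ k) ((ψ k).uAt (G.state ψ k))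

/-- The cost of player `i`. -/
noncomputable def J (G : QHGame n m s c) (i : Fin 2) (ψ : Strategies n m s) : ℝ :=
  G.gK i (G.state ψ G.K) ((ψ G.K).vAt (G.state ψ G.K)) +
    ∑ k ∈ Finset.range G.K,
      G.g k i (G.state ψ k) ((ψ k).uAt (G.state ψ k)) ((ψ k).vAt (G.state ψ k))

/-- Feedback Stackelberg-Nash solutions. -/
def IsFSN (G : QHGame n m s c) (ψs : Strategies n m s) : Prop :=
  G.Admissible ψs ∧
  -- terminal instant: a Nash equilibrium, whatever was played before
  (∀ ψ, G.AdmissibleBefore G.K ψ → ∀ i,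
    IsMinOn
      (fun w => G.J i
        (splice G.K ψ ⟨(ψs G.K).γ, Function.update (ψs G.K).v i w⟩ ψs))
      (G.simMaps G.K i (ψs G.K).v) ((ψs G.K).v i)) ∧
  ∀ k < G.K,
    -- third stage: a Nash equilibrium, whatever was played before and in the first two stages
    (∀ ψ, G.AdmissibleBefore k ψ → ∀ a ∈ G.leaderMaps k, ∀ b ∈ G.followerMaps k a, ∀ i,
      IsMinOn
        (fun w => G.J i (splice k ψ ⟨pair a b, Function.update (ψs k).v i w⟩ ψs))
        (G.simMaps k i (ψs k).v) ((ψs k).v i)) ∧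
    ∃ R : (Vec n → Vec (m 0)) → (Vec n → Vec (m 1)),
      -- second stage: `R a` is the unique best response of the follower to `a`
      (∀ a ∈ G.leaderMaps k,
        R a ∈ G.followerMaps k a ∧
        (∀ ψ, G.AdmissibleBefore k ψ →
          IsMinOn (fun b => G.J 1 (splice k ψ ⟨pair a b, (ψs k).v⟩ ψs))
            (G.followerMaps k a) (R a)) ∧
        ∀ b ∈ G.followerMaps k a,
          (∀ ψ, G.AdmissibleBefore k ψ →
            IsMinOn (fun b' => G.J 1 (splice k ψ ⟨pair a b', (ψs k).v⟩ ψs))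
              (G.followerMaps k a) b) →
          Set.EqOn b (R a) (G.Reach k)) ∧
      -- first stage: the leader minimizes against that response
      (∀ ψ, G.AdmissibleBefore k ψ →
        IsMinOn (fun a => G.J 0 (splice k ψ ⟨pair a (R a), (ψs k).v⟩ ψs))
          (G.leaderMaps k) ((ψs k).γ 0)) ∧
      Set.EqOn ((ψs k).γ 1) (R ((ψs k).γ 0)) (G.Reach k)

/-- The game that is left from the instant `k₀` on, started at the state `y`. -/
def subgame (G : QHGame n m s c) (k₀ : ℕ) (y : Vec n) : QHGame n m s c where
  K := G.K - k₀
  x0 := y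
  f := fun k => G.f (k₀ + k)
  h := fun k => G.h (k₀ + k)
  g := fun k => G.g (k₀ + k)
  gK := G.gK

/-- Strong time consistency: for every instant `k₀` and every admissible play `ψ` before `k₀`, not
only the play prescribed by `ψs`, the truncation of `ψs` solves the truncated game. -/
def IsStronglyTimeConsistent (G : QHGame n m s c) (ψs : Strategies n m s) : Prop :=
  ∀ k₀ ≤ G.K, ∀ ψ, G.AdmissibleBefore k₀ ψ →
    (G.subgame k₀ (G.state ψ k₀)).IsFSN (fun k => ψs (k₀ + k))

/-- Standing hypotheses. -/
structure Standing (G : QHGame n m s c) : Prop where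
  V_nonempty : ∀ k ≤ G.K, ∀ x ∈ G.Reach k, (G.V k x).Nonempty
  V_convex : ∀ k ≤ G.K, ∀ x ∈ G.Reach k, Convex ℝ (G.V k x)
  V_closed : ∀ k ≤ G.K, ∀ x ∈ G.Reach k, IsClosed (G.V k x)
  V_bounded : ∀ k ≤ G.K, ∀ x ∈ G.Reach k, Bornology.IsBounded (G.V k x)
  f_smooth : ∀ k < G.K, ContDiff ℝ 1 (fun p : Vec n × Joint m => G.f k p.1 p.2)
  h_smooth : ∀ k ≤ G.K, ∀ i, ContDiff ℝ 1 (fun p : Vec n × Joint s => G.h k i p.1 p.2)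
  g_smooth : ∀ k < G.K, ∀ i,
    ContDiff ℝ 1 (fun p : Vec n × Joint m × Joint s => G.g k i p.1 p.2.1 p.2.2)
  gK_smooth : ∀ i, ContDiff ℝ 1 (fun p : Vec n × Joint s => G.gK i p.1 p.2)
  /-- the partial Jacobian of `h k i` in the own decision of player `i` has full rank -/
  full_rank : ∀ k ≤ G.K, ∀ i, ∀ x ∈ G.Reach k, ∀ v ∈ G.V k x,
    Module.finrank ℝ
      (fderiv ℝ (fun w => G.h k i x (Function.update v i w)) (v i)).range = min (c i) (s i)

/-- Separability of the costs; `gv G.K` stands for the terminal cost. -/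
structure Separable (G : QHGame n m s c) (gu : ℕ → Fin 2 → Vec n → Joint m → ℝ)
    (gv : ℕ → Fin 2 → Vec n → Joint s → ℝ) : Prop where
  stage : ∀ k < G.K, ∀ i x u v, G.g k i x u v = gu k i x u + gv k i x v
  terminal : ∀ i x v, gv G.K i x v = G.gK i x v

/-- The gradient of the cost `q i` of player `i` in her own decision, at the joint decision `v`. -/
noncomputable def ownGrad (q : Fin 2 → Joint s → ℝ) (i : Fin 2) (v : Joint s) : Vec (s i) :=
  gradient (fun w => q i (Function.update v i w)) (v i)

/-- Diagonal strict convexity of a pair of cost functions. -/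
def DiagStrictConvex (q : Fin 2 → Joint s → ℝ) : Prop :=
  ∀ α β : Joint s, α ≠ β →
    ∑ i, inner ℝ (α i - β i) (ownGrad q i β) + ∑ i, inner ℝ (β i - α i) (ownGrad q i α) < 0

/-- The gradient of the Lagrangian of player `i` in her own decision. -/
noncomputable def lagGrad (G : QHGame n m s c) (gv : ℕ → Fin 2 → Vec n → Joint s → ℝ) (k : ℕ)
    (x : Vec n) (v : Joint s) (μ : Joint c) (i : Fin 2) : Vec (s i) :=
  ownGrad (fun j => gv k j x) i v -
    ContinuousLinearMap.adjoint
      (fderiv ℝ (fun w => G.h k i x (Function.update v i w)) (v i)) (μ i)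

/-- The solutions `(v, μ)` of the parametric complementarity problem
`0 ≤ (∇L, h) ⊥ (v, μ) ≥ 0`. -/
def SOL (G : QHGame n m s c) (gv : ℕ → Fin 2 → Vec n → Joint s → ℝ) (k : ℕ) (x : Vec n) :
    Set (Joint s × Joint c) :=
  {p | (∀ i l, 0 ≤ G.lagGrad gv k x p.1 p.2 i l) ∧ (∀ i l, 0 ≤ G.h k i x p.1 l) ∧
    (∀ i l, 0 ≤ p.1 i l) ∧ (∀ i l, 0 ≤ p.2 i l) ∧
    ∑ i, (inner ℝ (G.lagGrad gv k x p.1 p.2 i) (p.1 i) + inner ℝ (G.h k i x p.1) (p.2 i)) = 0}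

/-- The sequential part of the cost at `(k, x)` plus the continuation value. -/
def seqCost (G : QHGame n m s c) (gu : ℕ → Fin 2 → Vec n → Joint m → ℝ)
    (W : Fin 2 → ℕ → Vec n → ℝ) (k : ℕ) (i : Fin 2) (x : Vec n) (u : Joint m) : ℝ :=
  gu k i x u + W i (k + 1) (G.f k x u)

/-- Strict convexity of the cost of the follower over her admissible actions, for every admissible
policy of the leader. -/
def FollowerStrictConvex (G : QHGame n m s c) (gu : ℕ → Fin 2 → Vec n → Joint m → ℝ)
    (W : Fin 2 → ℕ → Vec n → ℝ) : Prop :=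
  ∀ k < G.K, ∀ a ∈ G.leaderMaps k, ∀ x ∈ G.Reach k,
    StrictConvexOn ℝ {w : Vec (m 1) | pair (a x) w ∈ G.U k x}
      (fun w => G.seqCost gu W k 1 x (pair (a x) w))

/-- The backward recursion for the value functions `W` and the strategies `ψs`. -/
structure Recursion (G : QHGame n m s c) (gu : ℕ → Fin 2 → Vec n → Joint m → ℝ)
    (gv : ℕ → Fin 2 → Vec n → Joint s → ℝ) (W : Fin 2 → ℕ → Vec n → ℝ)
    (ψs : Strategies n m s) : Prop where
  terminal : ∀ i, ∀ x ∈ G.Reach G.K, W i G.K x = G.gK i x ((ψs G.K).vAt x)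
  step : ∀ k < G.K, ∀ i, ∀ x ∈ G.Reach k,
    W i k x = G.g k i x ((ψs k).uAt x) ((ψs k).vAt x) + W i (k + 1) (G.f k x ((ψs k).uAt x))
  /-- the simultaneous decisions, with suitable multipliers, solve the complementarity problem -/
  simultaneous : ∀ k ≤ G.K, ∀ x ∈ G.Reach k, ∃ μ, ((ψs k).vAt x, μ) ∈ G.SOL gv k x
  /-- `R a` minimizes the cost of the follower against `a`; the policy of the leader minimizes her
  cost against `R`; the policy of the follower is the response to it -/
  sequential : ∀ k < G.K, ∃ R : (Vec n → Vec (m 0)) → (Vec n → Vec (m 1)),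
    (∀ a ∈ G.leaderMaps k, R a ∈ G.followerMaps k a ∧ ∀ x ∈ G.Reach k,
      IsMinOn (fun b => G.seqCost gu W k 1 x (pair (a x) (b x))) (G.followerMaps k a) (R a)) ∧
    (ψs k).γ 0 ∈ G.leaderMaps k ∧
    (∀ x ∈ G.Reach k,
      IsMinOn (fun a => G.seqCost gu W k 0 x (pair (a x) (R a x))) (G.leaderMaps k)
        ((ψs k).γ 0)) ∧
    Set.EqOn ((ψs k).γ 1) (R ((ψs k).γ 0)) (G.Reach k)

end QHGame

open Set

/-! The simultaneous decisions do not enter the dynamics and the costs are separable. Hence, when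
`ψs` is played after `k`, the cost is the past cost, plus a term in the decision `v` at `k`, plus
`seqCost` (`Recursion.J_splice`), because `W` is the cost-to-go (`Recursion.J_eq`). Each clause of
the solution concept then becomes a static problem at the current state.

For `v`, complementarity gives the variational inequality on the convex feasible set, and diagonal
strict convexity makes it sufficient for a Nash equilibrium (`SOL.le_update`). For `u`, minimality
is that of the recursion. The response is unique because a policy may be changed at a single state,
every reachable state is visited by some admissible play, and the follower's cost is strictly convex
there.

For time consistency, all data restrict to the subgame (`Recursion.subgame`). The delicate point is
that a leader policy of the subgame lives on a smaller reachable set and must be extended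
measurably. This works because reachable sets are σ-compact, hence Borel. -/

/-! ### Borel measurability of reachable sets and gluing of policies. -/

theorem IsSigmaCompact.inter_of_t2 {X : Type*} [TopologicalSpace X] [T2Space X] {A B : Set X}
    (hA : IsSigmaCompact A) (hB : IsSigmaCompact B) : IsSigmaCompact (A ∩ B) := by
  obtain ⟨P, hP, rfl⟩ := hA
  obtain ⟨Q, hQ, rfl⟩ := hB
  rw [iUnion_inter]
  refine isSigmaCompact_iUnion _ fun p => ?_
  rw [inter_iUnion]
  exact isSigmaCompact_iUnion_of_isCompact _ fun r => (hP p).inter (hQ r)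

theorem IsSigmaCompact.preimage_of_continuous {X Y : Type*} [TopologicalSpace X]
    [SigmaCompactSpace X] [TopologicalSpace Y] [T2Space Y] {A : Set Y} (hA : IsSigmaCompact A)
    {f : X → Y} (hf : Continuous f) : IsSigmaCompact (f ⁻¹' A) := by
  obtain ⟨P, hP, rfl⟩ := hA
  rw [preimage_iUnion]
  exact isSigmaCompact_iUnion _ fun p =>
    isSigmaCompact_univ.of_isClosed_subset ((hP p).isClosed.preimage hf) (subset_univ _)

theorem IsSigmaCompact.measurableSet {X : Type*} [TopologicalSpace X] [T2Space X]
    [MeasurableSpace X] [BorelSpace X] {A : Set X} (hA : IsSigmaCompact A) :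
    MeasurableSet A := by
  obtain ⟨P, hP, rfl⟩ := hA
  exact MeasurableSet.iUnion fun p => (hP p).measurableSet

/-- Only the set on which the policy is changed has to be measurable; `T` is arbitrary and need not
contain `S`. -/
theorem measurable_domRestrict_piecewise {X Y : Type*} [MeasurableSpace X] [MeasurableSpace Y]
    {S T : Set X} [DecidablePred (· ∈ S)] (hS : MeasurableSet S) {a b : X → Y} (ha : Measurable (S.domRestrict a))
    (hb : Measurable (T.domRestrict b)) : Measurable (T.domRestrict (S.piecewise a b)) := by
  have hS' : MeasurableSet {x : T | (x : X) ∈ S} := measurable_subtype_coe hS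
  refine measurable_of_measurable_union_cover _ {x : T | (x : X) ∈ S}ᶜ hS' hS'.compl
    (union_compl_self _).ge ?_ ?_
  · have h : Measurable fun z : {x : T | (x : X) ∈ S} => (⟨z.1.1, z.2⟩ : S) :=
      (measurable_subtype_coe.comp measurable_subtype_coe).subtype_mk
    convert! ha.comp h using 1
    funext z
    exact piecewise_eq_of_mem S a b z.2
  · convert! hb.comp (measurable_subtype_coe (p := fun x : T => x ∈ {x : T | (x : X) ∈ S}ᶜ)) using 1
    funext z
    exact piecewise_eq_of_notMem S a b z.2

namespace QHGame

variable {n : ℕ} {m s c : Fin 2 → ℕ} {G : QHGame n m s c}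

/-- This is the projection of a closed subset of a finite-dimensional space. Boundedness of `G.V k
x` is assumed only at reachable `x`, so closedness of the projection is not available. -/
theorem isSigmaCompact_feasible (hG : G.Standing) {k : ℕ} (hk : k ≤ G.K) :
    IsSigmaCompact {x | (G.V k x).Nonempty} := by
  have hcl : IsClosed {p : Vec n × Joint s | p.2 ∈ G.V k p.1} := by
    have : {p : Vec n × Joint s | p.2 ∈ G.V k p.1} =
        ⋂ i, (⋂ l, {p | 0 ≤ G.h k i p.1 p.2 l}) ∩ ⋂ l, {p | 0 ≤ p.2 i l} := by
      ext p
      simp [V]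
    rw [this]
    refine isClosed_iInter fun i => IsClosed.inter
      (isClosed_iInter fun l => ?_) (isClosed_iInter fun l => ?_)
    · have := (hG.h_smooth k hk i).continuous
      exact isClosed_le continuous_const (by fun_prop)
    · exact isClosed_le continuous_const (by fun_prop)
  have h := (isSigmaCompact_univ.of_isClosed_subset hcl (subset_univ _)).image continuous_fst
  convert! h using 1
  ext x
  constructor
  · rintro ⟨v, hv⟩
    exact ⟨(x, v), hv, rfl⟩
  · rintro ⟨⟨y, v⟩, hv, rfl⟩
    exact ⟨v, hv⟩

/-- Continuous images of Borel sets need not be Borel, whereas σ-compactness survives continuous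
images and so can be carried through the induction. -/
theorem isSigmaCompact_reach (hG : G.Standing) : ∀ {k : ℕ}, k ≤ G.K → IsSigmaCompact (G.Reach k)
  | 0, _ => isCompact_singleton.isSigmaCompact
  | k + 1, hk => by
    have hf := (hG.f_smooth k hk).continuous
    have h := (((isSigmaCompact_reach hG (Nat.le_of_succ_le hk)).preimage_of_continuous
      (continuous_fst (Y := Joint m))).inter_of_t2
      ((isSigmaCompact_feasible hG hk).preimage_of_continuous hf)).image hf
    convert! h using 1
    ext y
    constructor
    · rintro ⟨x, hx, u, hu, rfl⟩
      exact ⟨(x, u), ⟨hx, hu⟩, rfl⟩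
    · rintro ⟨⟨x, u⟩, ⟨hx, hu⟩, rfl⟩
      exact ⟨x, hx, u, hu, rfl⟩

theorem piecewise_mem_leaderMaps {k : ℕ} {a a' : Vec n → Vec (m 0)} (ha : a ∈ G.leaderMaps k)
    {S : Set (Vec n)} [DecidablePred (· ∈ S)] (hS : MeasurableSet S) (hm : Measurable (S.domRestrict a'))
    (hU : ∀ x ∈ S, ∃ u ∈ G.U k x, u 0 = a' x) : S.piecewise a' a ∈ G.leaderMaps k := by
  refine ⟨measurable_domRestrict_piecewise hS hm ha.1, fun x hx => ?_⟩
  by_cases hxS : x ∈ S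
  · rw [piecewise_eq_of_mem _ _ _ hxS]
    exact hU x hxS
  · rw [piecewise_eq_of_notMem _ _ _ hxS]
    exact ha.2 x hx

theorem piecewise_mem_followerMaps {k : ℕ} {a : Vec n → Vec (m 0)} {b b' : Vec n → Vec (m 1)}
    (hb : b ∈ G.followerMaps k a) {S : Set (Vec n)} [DecidablePred (· ∈ S)] (hS : MeasurableSet S)
    (hm : Measurable (S.domRestrict b')) (hU : ∀ x ∈ S, pair (a x) (b' x) ∈ G.U k x) :
    S.piecewise b' b ∈ G.followerMaps k a := by
  refine ⟨measurable_domRestrict_piecewise hS hm hb.1, fun x hx => ?_⟩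
  by_cases hxS : x ∈ S
  · rw [piecewise_eq_of_mem _ _ _ hxS]
    exact hU x hxS
  · rw [piecewise_eq_of_notMem _ _ _ hxS]
    exact hb.2 x hx

end QHGame

/-! ### From complementarity to a Nash equilibrium in the simultaneous decisions. -/

theorem inner_eq_sum_mul {d : ℕ} (a b : Vec d) : inner ℝ a b = ∑ l, a l * b l := by
  simp [PiLp.inner_apply, mul_comm]

theorem inner_nonneg_of_nonneg {d : ℕ} {a b : Vec d} (ha : ∀ l, 0 ≤ a l) (hb : ∀ l, 0 ≤ b l) :
    0 ≤ inner ℝ a b := by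
  rw [inner_eq_sum_mul]
  exact Finset.sum_nonneg fun l _ => mul_nonneg (ha l) (hb l)

namespace QHGame

variable {n : ℕ} {m s c : Fin 2 → ℕ} {G : QHGame n m s c}

theorem ownGrad_update (q : Fin 2 → Joint s → ℝ) (i : Fin 2) (v : Joint s) (z : Vec (s i)) :
    ownGrad q i (Function.update v i z) = gradient (fun w => q i (Function.update v i w)) z := by
  simp [ownGrad]

/-- For diagonally strictly convex costs the first-order condition is sufficient for a minimum in
the own decision. -/
theorem DiagStrictConvex.le_update {q : Fin 2 → Joint s → ℝ} (hq : DiagStrictConvex q) {i : Fin 2}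
    {v : Joint s} (hd : Differentiable ℝ fun w => q i (Function.update v i w)) {w : Vec (s i)}
    (h : 0 ≤ inner ℝ (ownGrad q i v) (w - v i)) : q i v ≤ q i (Function.update v i w) := by
  set d := w - v i with hdef
  rcases eq_or_ne d 0 with h0 | h0
  · rw [sub_eq_zero.1 h0, Function.update_eq_self]
  have hder : ∀ t : ℝ, HasDerivAt (fun t : ℝ => q i (Function.update v i (v i + t • d)))
      (inner ℝ (ownGrad q i (Function.update v i (v i + t • d))) d) t := by
    intro t
    rw [ownGrad_update]
    have h1 := (hd (v i + t • d)).hasGradientAt.hasFDerivAt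
    have h2 : HasDerivAt (fun t : ℝ => v i + t • d) d t := by
      simpa using ((hasDerivAt_id t).smul_const d).const_add (v i)
    have h3 := h1.comp_hasDerivAt t h2
    rw [InnerProductSpace.toDual_apply_apply] at h3
    exact h3
  -- By the mean value theorem the cost difference is the slope at an interior `t`. Diagonal strict
  -- convexity, applied to `v` and that point, makes this slope exceed the one at `v`; only the
  -- summand of player `i` survives.
  obtain ⟨t, ht, hslope⟩ := exists_hasDerivAt_eq_slope _ _ one_pos
    (fun t _ => (hder t).continuousAt.continuousWithinAt) fun t _ => hder t
  have hne : Function.update v i (v i + t • d) ≠ v := by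
    intro he
    have := congrFun he i
    rw [Function.update_self, add_eq_left, smul_eq_zero] at this
    exact this.elim ht.1.ne' h0
  have hlt := hq _ _ hne
  rw [Finset.sum_eq_single i (fun j _ hj => by simp [Function.update_of_ne hj]) (by simp),
    Finset.sum_eq_single i (fun j _ hj => by simp [Function.update_of_ne hj]) (by simp)] at hlt
  simp only [Function.update_self, add_sub_cancel_left, sub_add_cancel_left, inner_neg_left,
    real_inner_smul_left] at hlt
  rw [real_inner_comm] at h
  rw [real_inner_comm] at hslope
  have h3 : inner ℝ d (ownGrad q i v) <
      inner ℝ d (ownGrad q i (Function.update v i (v i + t • d))) := by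
    have := ht.1
    nlinarith
  have hw : v i + (1 : ℝ) • d = w := by simp [hdef]
  simp only [hw, zero_smul, add_zero, Function.update_eq_self, sub_zero, div_one] at hslope
  linarith

theorem SOL.inner_eq_zero {gv : ℕ → Fin 2 → Vec n → Joint s → ℝ} {k : ℕ} {x : Vec n}
    {p : Joint s × Joint c} (hp : p ∈ G.SOL gv k x) (i : Fin 2) :
    inner ℝ (G.lagGrad gv k x p.1 p.2 i) (p.1 i) = 0 ∧ inner ℝ (G.h k i x p.1) (p.2 i) = 0 := by
  obtain ⟨h1, h2, h3, h4, h5⟩ := hp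
  have ha := fun j => inner_nonneg_of_nonneg (h1 j) (h3 j)
  have hb := fun j => inner_nonneg_of_nonneg (h2 j) (h4 j)
  have := (Finset.sum_eq_zero_iff_of_nonneg fun j _ => add_nonneg (ha j) (hb j)).1 h5 i
    (Finset.mem_univ i)
  exact (add_eq_zero_iff_of_nonneg (ha i) (hb i)).1 this

theorem SOL.mem_V {gv : ℕ → Fin 2 → Vec n → Joint s → ℝ} {k : ℕ} {x : Vec n}
    {p : Joint s × Joint c} (hp : p ∈ G.SOL gv k x) : p.1 ∈ G.V k x :=
  fun i => ⟨hp.2.1 i, hp.2.2.1 i⟩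

/-- The solutions of the complementarity problem satisfy the first-order condition. -/
theorem SOL.inner_ownGrad_nonneg {gv : ℕ → Fin 2 → Vec n → Joint s → ℝ} {k : ℕ} {x : Vec n}
    {p : Joint s × Joint c} (hp : p ∈ G.SOL gv k x) (hV : Convex ℝ (G.V k x)) {i : Fin 2}
    (hd : Differentiable ℝ fun w => G.h k i x (Function.update p.1 i w)) {w : Vec (s i)}
    (hw : Function.update p.1 i w ∈ G.V k x) :
    0 ≤ inner ℝ (ownGrad (fun j => gv k j x) i p.1) (w - p.1 i) := by
  have hc := SOL.inner_eq_zero hp i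
  obtain ⟨v, μ⟩ := p
  dsimp only at *
  -- Convexity of the joint feasible set passes to its section in the own decision.
  have hseg : segment ℝ (v i) w ⊆ {z | Function.update v i z ∈ G.V k x} := by
    rintro z ⟨a, b, ha, hb, hab, rfl⟩
    have := hV (SOL.mem_V hp) hw ha hb hab
    change Function.update v i (a • v i + b • w) ∈ G.V k x
    convert! this using 1
    funext j
    rcases eq_or_ne j i with rfl | hj
    · simp
    · simp [Function.update_of_ne hj, ← add_smul, hab]
  -- Componentwise, either the multiplier vanishes or the constraint is active. An active constraint
  -- function is minimal at `v i` over the feasible section, so its derivative towards `w` is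
  -- nonnegative.
  have hμ : 0 ≤ inner ℝ (μ i)
      (fderiv ℝ (fun w => G.h k i x (Function.update v i w)) (v i) (w - v i)) := by
    rw [inner_eq_sum_mul]
    refine Finset.sum_nonneg fun l _ => ?_
    have hl : G.h k i x v l * μ i l = 0 := by
      have h2 := hc.2
      rw [inner_eq_sum_mul] at h2
      exact (Finset.sum_eq_zero_iff_of_nonneg fun l _ =>
        mul_nonneg (hp.2.1 i l) (hp.2.2.2.1 i l)).1 h2 l (Finset.mem_univ l)
    rcases mul_eq_zero.1 hl with h0 | h0
    · refine mul_nonneg (hp.2.2.2.1 i l) ?_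
      have hF := (EuclideanSpace.proj (𝕜 := ℝ) l).hasFDerivAt.comp (v i) (hd (v i)).hasFDerivAt
      have hmin : IsMinOn (fun z => G.h k i x (Function.update v i z) l)
          {z | Function.update v i z ∈ G.V k x} (v i) := by
        intro z hz
        simpa [h0] using (hz i).1 l
      exact hmin.localize.hasFDerivWithinAt_nonneg hF.hasFDerivWithinAt
        (sub_mem_posTangentConeAt_of_segment_subset hseg)
    · simp [h0]
  have hL : 0 ≤ inner ℝ (G.lagGrad gv k x v μ i) (w - v i) := by
    rw [inner_sub_right, hc.1, sub_zero]
    refine inner_nonneg_of_nonneg (hp.1 i) fun l => ?_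
    simpa using (hw i).2 l
  rw [lagGrad, inner_sub_left, ContinuousLinearMap.adjoint_inner_left] at hL
  linarith

/-- Smoothness is assumed for the full costs only. Before the horizon, freezing `u = 0` recovers
`gv` up to a constant. -/
theorem differentiable_gv (hG : G.Standing) {gu : ℕ → Fin 2 → Vec n → Joint m → ℝ}
    {gv : ℕ → Fin 2 → Vec n → Joint s → ℝ} (hsep : G.Separable gu gv) {k : ℕ} (hk : k ≤ G.K)
    (i : Fin 2) (x : Vec n) : Differentiable ℝ (gv k i x) := by
  rcases hk.lt_or_eq with hk | rfl
  · have h := (hG.g_smooth k hk i).differentiable one_ne_zero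
    have he : gv k i x = fun v => G.g k i x 0 v - gu k i x 0 := by
      funext v
      rw [hsep.stage k hk]
      ring
    rw [he]
    exact (h.comp (by fun_prop : Differentiable ℝ fun v : Joint s =>
      (x, ((0 : Joint m), v)))).sub_const _
  · have h := (hG.gK_smooth i).differentiable one_ne_zero
    have he : gv G.K i x = fun v => G.gK i x v := funext (hsep.terminal i x)
    rw [he]
    exact h.comp (by fun_prop : Differentiable ℝ fun v : Joint s => (x, v))

/-- The solutions of the complementarity problem are Nash equilibria of the simultaneous game. -/
theorem SOL.le_update (hG : G.Standing) {gu : ℕ → Fin 2 → Vec n → Joint m → ℝ}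
    {gv : ℕ → Fin 2 → Vec n → Joint s → ℝ} (hsep : G.Separable gu gv) {k : ℕ} (hk : k ≤ G.K)
    {x : Vec n} (hx : x ∈ G.Reach k) (hq : DiagStrictConvex fun i => gv k i x)
    {p : Joint s × Joint c} (hp : p ∈ G.SOL gv k x) {i : Fin 2} {w : Vec (s i)}
    (hw : Function.update p.1 i w ∈ G.V k x) :
    gv k i x p.1 ≤ gv k i x (Function.update p.1 i w) := by
  have hu : Differentiable ℝ (Function.update p.1 i) := fun z =>
    (hasFDerivAt_update p.1 z).differentiableAt
  have hh := (hG.h_smooth k hk i).differentiable one_ne_zero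
  exact hq.le_update ((differentiable_gv hG hsep hk i x).comp hu)
    (SOL.inner_ownGrad_nonneg hp (hG.V_convex k hk x hx)
      (hh.comp ((differentiable_const x).prodMk hu)) hw)

end QHGame

/-! ### Spliced plays and the cost-to-go. -/

theorem pair_self {A : Fin 2 → Type*} (a : (i : Fin 2) → A i) : pair (a 0) (a 1) = a := by
  funext i
  fin_cases i <;> rfl

namespace Stage

variable {n : ℕ} {m s : Fin 2 → ℕ}

theorem uAt_mk_pair (a : Vec n → Vec (m 0)) (b : Vec n → Vec (m 1))
    (v : (i : Fin 2) → Vec n → Vec (s i)) (x : Vec n) :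
    (⟨pair a b, v⟩ : Stage n m s).uAt x = pair (a x) (b x) := by
  funext i
  fin_cases i <;> rfl

theorem uAt_eq_pair (σ : Stage n m s) (x : Vec n) : σ.uAt x = pair (σ.γ 0 x) (σ.γ 1 x) :=
  (pair_self (A := fun i => Vec (m i)) (σ.uAt x)).symm

theorem vAt_mk_update (σ : Stage n m s) (γ : (i : Fin 2) → Vec n → Vec (m i)) (i : Fin 2)
    (w : Vec n → Vec (s i)) (x : Vec n) :
    (⟨γ, Function.update σ.v i w⟩ : Stage n m s).vAt x = Function.update (σ.vAt x) i (w x) := by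
  funext j
  rcases eq_or_ne j i with rfl | hj
  · simp [vAt]
  · simp [vAt, Function.update_of_ne hj]

end Stage

section splice

variable {n : ℕ} {m s : Fin 2 → ℕ} {k t : ℕ} (ψ : Strategies n m s) (σ : Stage n m s)
  (ψs : Strategies n m s)

theorem splice_of_lt (h : t < k) : splice k ψ σ ψs t = ψ t := if_pos h

theorem splice_self : splice k ψ σ ψs k = σ := by simp [splice]

theorem splice_of_gt (h : k < t) : splice k ψ σ ψs t = ψs t := by
  simp [splice, h.not_gt, h.ne']

end splice

namespace QHGame

variable {n : ℕ} {m s c : Fin 2 → ℕ} {G : QHGame n m s c}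

theorem state_congr {ψ φ : Strategies n m s} {k : ℕ} (h : ∀ t < k, ψ t = φ t) :
    G.state ψ k = G.state φ k := by
  induction k with
  | zero => rfl
  | succ k ih =>
    rw [state, state, ih fun t ht => h t (ht.trans k.lt_succ_self), h k k.lt_succ_self]

theorem state_splice (ψ : Strategies n m s) (σ : Stage n m s) (ψs : Strategies n m s) {k t : ℕ}
    (h : t ≤ k) : G.state (splice k ψ σ ψs) t = G.state ψ t :=
  state_congr fun _ hr => splice_of_lt ψ σ ψs (hr.trans_le h)

theorem AdmissibleAt.uAt_mem {k : ℕ} {σ : Stage n m s} (h : G.AdmissibleAt k σ) {x : Vec n}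
    (hx : x ∈ G.Reach k) : σ.uAt x ∈ G.U k x := by
  rw [σ.uAt_eq_pair]
  exact h.2.1.2 x hx

theorem AdmissibleBefore.state_mem {k : ℕ} {ψ : Strategies n m s} (h : G.AdmissibleBefore k ψ) :
    G.state ψ k ∈ G.Reach k := by
  induction k with
  | zero => rfl
  | succ k ih =>
    have hx := ih fun t ht => h t (ht.trans k.lt_succ_self)
    exact ⟨_, hx, _, (h k k.lt_succ_self).uAt_mem hx, rfl⟩

/-- The cost accumulated before the instant `k`. -/
noncomputable def costBefore (G : QHGame n m s c) (i : Fin 2) (ψ : Strategies n m s) (k : ℕ) : ℝ :=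
  ∑ t ∈ Finset.range k, G.g t i (G.state ψ t) ((ψ t).uAt (G.state ψ t)) ((ψ t).vAt (G.state ψ t))

theorem costBefore_splice (i : Fin 2) (ψ : Strategies n m s) (σ : Stage n m s)
    (ψs : Strategies n m s) (k : ℕ) :
    G.costBefore i (splice k ψ σ ψs) k = G.costBefore i ψ k := by
  refine Finset.sum_congr rfl fun t ht => ?_
  have ht := Finset.mem_range.1 ht
  rw [state_splice ψ σ ψs ht.le, splice_of_lt ψ σ ψs ht]

theorem J_splice_terminal (i : Fin 2) (ψ : Strategies n m s) (σ : Stage n m s)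
    (ψs : Strategies n m s) :
    G.J i (splice G.K ψ σ ψs) =
      G.gK i (G.state ψ G.K) (σ.vAt (G.state ψ G.K)) + G.costBefore i ψ G.K := by
  rw [← costBefore_splice i ψ σ ψs, J, state_splice ψ σ ψs le_rfl, splice_self]
  rfl

variable {gu : ℕ → Fin 2 → Vec n → Joint m → ℝ} {gv : ℕ → Fin 2 → Vec n → Joint s → ℝ}
  {W : Fin 2 → ℕ → Vec n → ℝ} {ψs : Strategies n m s}

theorem Recursion.vAt_mem (hrec : G.Recursion gu gv W ψs) {k : ℕ} (hk : k ≤ G.K) {x : Vec n}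
    (hx : x ∈ G.Reach k) : (ψs k).vAt x ∈ G.V k x :=
  let ⟨_, hμ⟩ := hrec.simultaneous k hk x hx
  SOL.mem_V hμ

theorem followerMaps_congr {k : ℕ} {a : Vec n → Vec (m 0)} {b b' : Vec n → Vec (m 1)}
    (h : EqOn b b' (G.Reach k)) (hb : b' ∈ G.followerMaps k a) : b ∈ G.followerMaps k a := by
  refine ⟨?_, fun x hx => ?_⟩
  · rw [domRestrict_eq_domRestrict_iff.2 h]
    exact hb.1
  · rw [h hx]
    exact hb.2 x hx

theorem Recursion.admissibleAt (hrec : G.Recursion gu gv W ψs) {k : ℕ} (hk : k < G.K) :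
    G.AdmissibleAt k (ψs k) := by
  obtain ⟨R, hR, h0, -, h1⟩ := hrec.sequential k hk
  exact ⟨h0, followerMaps_congr h1 (hR _ h0).1, fun x hx => hrec.vAt_mem hk.le hx⟩

/-- `W` is the cost-to-go under `ψs`. -/
theorem Recursion.J_eq (hrec : G.Recursion gu gv W ψs) {φ : Strategies n m s} (i : Fin 2) {k : ℕ}
    (hk : k ≤ G.K) (hφ : ∀ t, k ≤ t → φ t = ψs t) (hx : G.state φ k ∈ G.Reach k) :
    G.J i φ = G.costBefore i φ k + W i k (G.state φ k) := by
  induction hk using Nat.decreasingInduction with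
  | self =>
    rw [hrec.terminal i _ hx, ← hφ G.K le_rfl, add_comm]
    rfl
  | @of_succ k hk ih =>
    have hu := (hrec.admissibleAt hk).uAt_mem hx
    have hk' : φ k = ψs k := hφ k le_rfl
    rw [ih (fun t ht => hφ t (Nat.le_of_succ_le ht)) ⟨_, hx, _, hk' ▸ hu, rfl⟩,
      hrec.step k hk i _ hx, costBefore, Finset.sum_range_succ, ← costBefore, ← hk', state]
    ring

/-- Admissibility of the action at `k` keeps the next state reachable, where `W` is the cost-to-go.
The `v` and `u` parts then decouple, so each can be optimized alone. -/
theorem Recursion.J_splice (hrec : G.Recursion gu gv W ψs) (hsep : G.Separable gu gv) (i : Fin 2)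
    {k : ℕ} (hk : k < G.K) {ψ : Strategies n m s} (hψ : G.AdmissibleBefore k ψ)
    {σ : Stage n m s} (hσ : σ.uAt (G.state ψ k) ∈ G.U k (G.state ψ k)) :
    G.J i (splice k ψ σ ψs) = G.costBefore i ψ k + gv k i (G.state ψ k) (σ.vAt (G.state ψ k)) +
      G.seqCost gu W k i (G.state ψ k) (σ.uAt (G.state ψ k)) := by
  have hs : G.state (splice k ψ σ ψs) (k + 1) =
      G.f k (G.state ψ k) (σ.uAt (G.state ψ k)) := by
    rw [state, state_splice ψ σ ψs le_rfl, splice_self]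
  rw [hrec.J_eq i hk (fun t ht => splice_of_gt ψ σ ψs ht)
    (hs ▸ ⟨_, hψ.state_mem, _, hσ, rfl⟩), hs, costBefore, Finset.sum_range_succ, ← costBefore,
    costBefore_splice, state_splice ψ σ ψs le_rfl, splice_self, hsep.stage k hk, seqCost]
  ring

end QHGame

/-! ### Verification of the equilibrium conditions. -/

namespace QHGame

variable {n : ℕ} {m s c : Fin 2 → ℕ} {G : QHGame n m s c}
variable {gu : ℕ → Fin 2 → Vec n → Joint m → ℝ} {gv : ℕ → Fin 2 → Vec n → Joint s → ℝ}
  {W : Fin 2 → ℕ → Vec n → ℝ} {ψs : Strategies n m s}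

theorem measurable_domRestrict_singleton {X Y : Type*} [MeasurableSpace X] [MeasurableSpace Y]
    (a : X → Y) (x : X) : Measurable (({x} : Set X).domRestrict a) :=
  Subsingleton.measurable

/-- Every reachable state is reached by an admissible play. -/
theorem Recursion.exists_admissibleBefore (hrec : G.Recursion gu gv W ψs) {k : ℕ} (hk : k ≤ G.K)
    {x : Vec n} (hx : x ∈ G.Reach k) : ∃ ψ, G.AdmissibleBefore k ψ ∧ G.state ψ k = x := by
  classical
  induction k generalizing x with
  | zero => exact ⟨ψs, fun t ht => absurd ht t.not_lt_zero, hx.symm⟩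
  | succ k ih =>
    obtain ⟨y, hy, u, hu, rfl⟩ := hx
    obtain ⟨ψ, hψ, rfl⟩ := ih (Nat.le_of_succ_le hk) hy
    set y := G.state ψ k with hydef
    obtain ⟨R, hR, h0, -, -⟩ := hrec.sequential k hk
    -- Changing the policies at `y` alone steers the play to the target and leaves them admissible.
    have ha : ({y} : Set (Vec n)).piecewise (fun _ => u 0) ((ψs k).γ 0) ∈ G.leaderMaps k := by
      refine piecewise_mem_leaderMaps h0 (measurableSet_singleton y)
        (measurable_domRestrict_singleton _ y) ?_
      rintro _ rfl
      exact ⟨u, hu, rfl⟩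
    set a := ({y} : Set (Vec n)).piecewise (fun _ => u 0) ((ψs k).γ 0)
    have hay : a y = u 0 := piecewise_eq_of_mem _ _ _ rfl
    -- `R a` serves as the base because it is admissible against the modified `a`.
    have hb : ({y} : Set (Vec n)).piecewise (fun _ => u 1) (R a) ∈ G.followerMaps k a := by
      refine piecewise_mem_followerMaps (hR a ha).1 (measurableSet_singleton y)
        (measurable_domRestrict_singleton _ y) ?_
      rintro _ rfl
      rw [hay, pair_self]
      exact hu
    set b := ({y} : Set (Vec n)).piecewise (fun _ => u 1) (R a)
    have hby : b y = u 1 := piecewise_eq_of_mem _ _ _ rfl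
    refine ⟨splice k ψ ⟨pair a b, (ψs k).v⟩ ψs, fun t ht => ?_, ?_⟩
    · rcases (Nat.lt_succ_iff.1 ht).lt_or_eq with ht | rfl
      · rw [splice_of_lt _ _ _ ht]
        exact hψ t ht
      · rw [splice_self]
        exact ⟨ha, hb, fun x hx => hrec.vAt_mem (Nat.le_of_succ_le hk) hx⟩
    · rw [state, state_splice _ _ _ le_rfl, splice_self, Stage.uAt_mk_pair, ← hydef, hay, hby,
        pair_self]

/-- Minimality over the policies of the follower is minimality over her actions at each state. -/
theorem isMinOn_of_isMinOn_followerMaps {k : ℕ} {a : Vec n → Vec (m 0)} {b : Vec n → Vec (m 1)}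
    (hb : b ∈ G.followerMaps k a) {x : Vec n} {F : Vec (m 1) → ℝ}
    (h : IsMinOn (fun b' => F (b' x)) (G.followerMaps k a) b) :
    IsMinOn F {w | pair (a x) w ∈ G.U k x} (b x) := by
  classical
  intro w hw
  have hb' : ({x} : Set (Vec n)).piecewise (fun _ => w) b ∈ G.followerMaps k a := by
    refine piecewise_mem_followerMaps hb (measurableSet_singleton x)
      (measurable_domRestrict_singleton _ x) ?_
    rintro _ rfl
    exact hw
  simpa using h hb'

theorem Recursion.isFSN (hrec : G.Recursion gu gv W ψs) (hG : G.Standing)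
    (hsep : G.Separable gu gv)
    (hdsc : ∀ k ≤ G.K, ∀ x ∈ G.Reach k, DiagStrictConvex (fun i => gv k i x))
    (hconv : G.FollowerStrictConvex gu W) : G.IsFSN ψs := by
  have hnash : ∀ k ≤ G.K, ∀ x ∈ G.Reach k, ∀ i, ∀ w ∈ G.simMaps k i (ψs k).v,
      gv k i x ((ψs k).vAt x) ≤ gv k i x (Function.update ((ψs k).vAt x) i (w x)) := by
    intro k hk x hx i w hw
    obtain ⟨μ, hμ⟩ := hrec.simultaneous k hk x hx
    exact SOL.le_update hG hsep hk hx (hdsc k hk x hx) hμ (hw x hx)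
  refine ⟨⟨fun t ht => hrec.admissibleAt ht, fun x hx => hrec.vAt_mem le_rfl hx⟩, ?_, ?_⟩
  · intro ψ hψ i w hw
    have h := hnash G.K le_rfl _ hψ.state_mem i w hw
    simp only [mem_ofPred_eq, J_splice_terminal, Stage.vAt_mk_update, ← hsep.terminal]
    have h0 : (Function.update ((ψs G.K).vAt (G.state ψ G.K)) i
        ((ψs G.K).v i (G.state ψ G.K))) = (ψs G.K).vAt (G.state ψ G.K) :=
      Function.update_eq_self i _
    rw [h0]
    linarith
  intro k hk
  have hJ : ∀ (i) {ψ : Strategies n m s}, G.AdmissibleBefore k ψ → ∀ (a b)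
      (v : (i : Fin 2) → Vec n → Vec (s i)), b ∈ G.followerMaps k a →
      G.J i (splice k ψ ⟨pair a b, v⟩ ψs) = G.costBefore i ψ k +
        gv k i (G.state ψ k) (fun j => v j (G.state ψ k)) +
        G.seqCost gu W k i (G.state ψ k) (pair (a (G.state ψ k)) (b (G.state ψ k))) := by
    intro i ψ hψ a b v hb
    have hu := hb.2 _ hψ.state_mem
    rw [← Stage.uAt_mk_pair a b v] at hu ⊢
    exact hrec.J_splice hsep i hk hψ hu
  obtain ⟨R, hR, h0, hmin, h1⟩ := hrec.sequential k hk
  refine ⟨?_, R, ?_, ?_, h1⟩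
  · intro ψ hψ a ha b hb i w hw
    have h := hnash k hk.le _ hψ.state_mem i w hw
    have hup : ∀ w' : Vec n → Vec (s i), (fun j => Function.update (ψs k).v i w' j (G.state ψ k)) =
        Function.update ((ψs k).vAt (G.state ψ k)) i (w' (G.state ψ k)) := fun w' =>
      Stage.vAt_mk_update (ψs k) (ψs k).γ i w' _
    have he : (Function.update ((ψs k).vAt (G.state ψ k)) i ((ψs k).v i (G.state ψ k))) =
        (ψs k).vAt (G.state ψ k) := Function.update_eq_self i _
    simp only [mem_ofPred_eq, hJ i hψ a b _ hb, hup, he]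
    linarith
  · intro a ha
    obtain ⟨hRa, hRmin⟩ := hR a ha
    refine ⟨hRa, fun ψ hψ b hb => ?_, fun b hb hbmin x hx => ?_⟩
    · have h : G.seqCost gu W k 1 _ (pair (a _) (R a _)) ≤ G.seqCost gu W k 1 _ (pair (a _) (b _)) :=
        hRmin _ hψ.state_mem hb
      simp only [mem_ofPred_eq, hJ 1 hψ a _ _ hb, hJ 1 hψ a _ _ hRa]
      linarith
    -- A play through `x` tests `b` at this state: `b x` and `R a x` both minimize a strictly convex
    -- function, so they agree.
    · obtain ⟨ψ, hψ, rfl⟩ := hrec.exists_admissibleBefore hk.le hx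
      have hmR := isMinOn_of_isMinOn_followerMaps hRa
        (F := fun w => G.seqCost gu W k 1 (G.state ψ k) (pair (a (G.state ψ k)) w)) (hRmin _ hx)
      have hle := hbmin ψ hψ hRa
      simp only [mem_ofPred_eq, hJ 1 hψ a _ _ hb, hJ 1 hψ a _ _ hRa] at hle
      refine (hconv k hk a ha _ hx).eq_of_isMinOn (fun w hw => ?_) hmR (hb.2 _ hx) (hRa.2 _ hx)
      have := hmR hw
      simp only [mem_ofPred_eq] at this ⊢
      linarith
  · intro ψ hψ a ha
    have h : G.seqCost gu W k 0 _ (pair ((ψs k).γ 0 _) (R ((ψs k).γ 0) _)) ≤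
        G.seqCost gu W k 0 _ (pair (a _) (R a _)) := hmin _ hψ.state_mem ha
    simp only [mem_ofPred_eq, hJ 0 hψ _ _ _ (hR _ ha).1, hJ 0 hψ _ _ _ (hR _ h0).1]
    linarith

/-! ### Restriction of the recursion to subgames. -/

section subgame

variable {k₀ : ℕ} {y : Vec n}

theorem reach_subgame_subset (hy : y ∈ G.Reach k₀) (k : ℕ) :
    (G.subgame k₀ y).Reach k ⊆ G.Reach (k₀ + k) := by
  induction k with
  | zero =>
    rintro _ rfl
    exact hy
  | succ k ih =>
    rintro _ ⟨x, hx, u, hu, rfl⟩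
    exact ⟨x, ih hx, u, hu, rfl⟩

theorem add_lt_of_lt_subgame {k : ℕ} (hk : k < (G.subgame k₀ y).K) : k₀ + k < G.K := by
  change k < G.K - k₀ at hk
  omega

theorem add_le_of_le_subgame (hk₀ : k₀ ≤ G.K) {k : ℕ} (hk : k ≤ (G.subgame k₀ y).K) :
    k₀ + k ≤ G.K := by
  change k ≤ G.K - k₀ at hk
  omega

theorem add_subgame_K (hk₀ : k₀ ≤ G.K) : k₀ + (G.subgame k₀ y).K = G.K :=
  Nat.add_sub_cancel' hk₀

theorem Standing.subgame (hG : G.Standing) (hk₀ : k₀ ≤ G.K) (hy : y ∈ G.Reach k₀) :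
    (G.subgame k₀ y).Standing where
  V_nonempty k hk x hx :=
    hG.V_nonempty _ (add_le_of_le_subgame hk₀ hk) x (reach_subgame_subset hy k hx)
  V_convex k hk x hx :=
    hG.V_convex _ (add_le_of_le_subgame hk₀ hk) x (reach_subgame_subset hy k hx)
  V_closed k hk x hx :=
    hG.V_closed _ (add_le_of_le_subgame hk₀ hk) x (reach_subgame_subset hy k hx)
  V_bounded k hk x hx :=
    hG.V_bounded _ (add_le_of_le_subgame hk₀ hk) x (reach_subgame_subset hy k hx)
  f_smooth _ hk := hG.f_smooth _ (add_lt_of_lt_subgame hk)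
  h_smooth _ hk := hG.h_smooth _ (add_le_of_le_subgame hk₀ hk)
  g_smooth _ hk := hG.g_smooth _ (add_lt_of_lt_subgame hk)
  gK_smooth := hG.gK_smooth
  full_rank k hk i x hx :=
    hG.full_rank _ (add_le_of_le_subgame hk₀ hk) i x (reach_subgame_subset hy k hx)

theorem Separable.subgame (hsep : G.Separable gu gv) (hk₀ : k₀ ≤ G.K) :
    (G.subgame k₀ y).Separable (fun k => gu (k₀ + k)) (fun k => gv (k₀ + k)) where
  stage _ hk := hsep.stage _ (add_lt_of_lt_subgame hk)
  terminal := by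
    rw [add_subgame_K hk₀]
    exact hsep.terminal

/-- A policy of the leader in a subgame extends to a policy in the whole game. -/
theorem piecewise_mem_leaderMaps_of_subgame (hG : G.Standing) (hk₀ : k₀ ≤ G.K)
    (hy : y ∈ G.Reach k₀) {k : ℕ} (hk : k < (G.subgame k₀ y).K)
    [DecidablePred (· ∈ (G.subgame k₀ y).Reach k)] {a a' : Vec n → Vec (m 0)}
    (ha : a ∈ G.leaderMaps (k₀ + k)) (ha' : a' ∈ (G.subgame k₀ y).leaderMaps k) :
    ((G.subgame k₀ y).Reach k).piecewise a' a ∈ G.leaderMaps (k₀ + k) :=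
  piecewise_mem_leaderMaps ha (isSigmaCompact_reach (hG.subgame hk₀ hy) hk.le).measurableSet
    ha'.1 ha'.2

theorem mem_followerMaps_subgame (hy : y ∈ G.Reach k₀) {k : ℕ} {a a' : Vec n → Vec (m 0)}
    {b : Vec n → Vec (m 1)} (hb : b ∈ G.followerMaps (k₀ + k) a)
    (h : EqOn a a' ((G.subgame k₀ y).Reach k)) : b ∈ (G.subgame k₀ y).followerMaps k a' := by
  refine ⟨hb.1.comp (measurable_inclusion (reach_subgame_subset hy k)), fun x hx => ?_⟩
  rw [← h hx]
  exact hb.2 x (reach_subgame_subset hy k hx)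

/-- The hypothesis concerns leader policies of the whole game, so `a'` is first extended by the
prescribed policy. -/
theorem FollowerStrictConvex.subgame (hconv : G.FollowerStrictConvex gu W) (hG : G.Standing)
    (hrec : G.Recursion gu gv W ψs) (hk₀ : k₀ ≤ G.K) (hy : y ∈ G.Reach k₀) :
    (G.subgame k₀ y).FollowerStrictConvex (fun k => gu (k₀ + k)) (fun i k => W i (k₀ + k)) := by
  classical
  intro k hk a' ha' x hx
  have hk' := add_lt_of_lt_subgame hk
  have h := hconv _ hk' _
    (piecewise_mem_leaderMaps_of_subgame hG hk₀ hy hk (hrec.admissibleAt hk').1 ha') x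
    (reach_subgame_subset hy k hx)
  rw [piecewise_eq_of_mem _ _ _ hx] at h
  exact h

/-- A response map acts on whole policies, so the one for the subgame extends the leader's policy by
`E` and then applies `R`. -/
theorem Recursion.subgame (hrec : G.Recursion gu gv W ψs) (hG : G.Standing) (hk₀ : k₀ ≤ G.K)
    (hy : y ∈ G.Reach k₀) :
    (G.subgame k₀ y).Recursion (fun k => gu (k₀ + k)) (fun k => gv (k₀ + k))
      (fun i k => W i (k₀ + k)) (fun k => ψs (k₀ + k)) where
  terminal i x hx := by
    have hx' := reach_subgame_subset hy _ hx
    simp only [add_subgame_K hk₀] at hx' ⊢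
    exact hrec.terminal i x hx'
  step k hk i x hx := hrec.step _ (add_lt_of_lt_subgame hk) i x (reach_subgame_subset hy k hx)
  simultaneous k hk x hx :=
    hrec.simultaneous _ (add_le_of_le_subgame hk₀ hk) x (reach_subgame_subset hy k hx)
  sequential k hk := by
    classical
    obtain ⟨R, hR, h0, hmin, h1⟩ := hrec.sequential _ (add_lt_of_lt_subgame hk)
    have hsub := reach_subgame_subset hy k
    set S := (G.subgame k₀ y).Reach k
    set E : (Vec n → Vec (m 0)) → (Vec n → Vec (m 0)) :=
      fun a => S.piecewise a ((ψs (k₀ + k)).γ 0)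
    have hEa : ∀ a, EqOn (E a) a S := fun a x hx => piecewise_eq_of_mem _ _ _ hx
    -- The extension fixes the prescribed policy, so its response is still the prescribed one.
    have hE0 : E ((ψs (k₀ + k)).γ 0) = (ψs (k₀ + k)).γ 0 := piecewise_same _ _
    have hEm : ∀ a ∈ (G.subgame k₀ y).leaderMaps k, E a ∈ G.leaderMaps (k₀ + k) := fun a ha =>
      piecewise_mem_leaderMaps_of_subgame hG hk₀ hy hk h0 ha
    refine ⟨fun a => R (E a), fun a ha => ?_, ?_, fun x hx a ha => ?_, ?_⟩
    · obtain ⟨hRa, hRmin⟩ := hR _ (hEm a ha)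
      refine ⟨mem_followerMaps_subgame hy hRa (hEa a), fun x hx b hb => ?_⟩
      -- Comparing actions at `x` avoids extending the follower's deviation `b` to the larger
      -- reachable set.
      have := isMinOn_of_isMinOn_followerMaps hRa
        (F := fun w => G.seqCost gu W (k₀ + k) 1 x (pair (E a x) w)) (hRmin x (hsub hx))
      rw [hEa a hx] at this
      exact this (hb.2 x hx)
    · exact ⟨h0.1.comp (measurable_inclusion hsub), fun x hx => h0.2 x (hsub hx)⟩
    · have := hmin x (hsub hx) (hEm a ha)
      simp only [mem_ofPred_eq, hEa a hx] at this
      simp only [mem_ofPred_eq, hE0]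
      exact this
    · simp only [hE0]
      exact h1.mono hsub

end subgame

end QHGame

theorem theorem1 {n : ℕ} {m s c : Fin 2 → ℕ} (G : QHGame n m s c) (hG : G.Standing)
    (gu : ℕ → Fin 2 → Vec n → Joint m → ℝ) (gv : ℕ → Fin 2 → Vec n → Joint s → ℝ)
    (hsep : G.Separable gu gv)
    (hdsc : ∀ k ≤ G.K, ∀ x ∈ G.Reach k, QHGame.DiagStrictConvex (fun i => gv k i x))
    (W : Fin 2 → ℕ → Vec n → ℝ) (hconv : G.FollowerStrictConvex gu W)
    (ψs : Strategies n m s) (hrec : G.Recursion gu gv W ψs) :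
    G.IsFSN ψs ∧ G.IsStronglyTimeConsistent ψs := by
  refine ⟨hrec.isFSN hG hsep hdsc hconv, fun k₀ hk₀ ψ hψ => ?_⟩
  have hy := hψ.state_mem
  exact (hrec.subgame hG hk₀ hy).isFSN (hG.subgame hk₀ hy) (hsep.subgame hk₀)
    (fun k hk x hx => hdsc _ (QHGame.add_le_of_le_subgame hk₀ hk) x
      (QHGame.reach_subgame_subset hy k hx))
    (hconv.subgame hG hrec hk₀ hy)
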